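/- **Setting.** A *quantum system* is a complex Hilbert space $\mathcal H$ (of any dimension); the systems considered include $\mathbb C$ and are closed under the Hilbert space tensor product. A *quantum resource theory* assigns to every system $\mathcal H$ a set $\mathcal S(\mathcal H)$ of density operators on $\mathcal H$, compact in the trace norm topology, with $1\in\mathcal S(\mathbb C)$ and $\rho\otimes\sigma\in\mathcal S(\mathcal H\otimes\mathcal H')$ for $\rho\in\mathcal S(\mathcal H)$, $\sigma\in\mathcal S(\mathcal H')$, and to every pair of systems a set $\mathcal O(\mathcal H\to\mathcal H')$ of completely positive trace-preserving maps (*free operations*), compact in the bounded weak topology and mapping $\mathcal S(\mathcal H)$ into $\mathcal S(\mathcal H')$, such that compositions and tensor products of free operations are free, the identity is free, and the trace $\mathcal H\to\mathbb C$ is free. For $\phi,\psi\in\mathcal S(\mathcal H)$ write $\phi\succeq\psi$ if $\mathcal N(\phi)=\psi$ for some $\mathcal N\in\mathcal O(\mathcal H\to\mathcal H)$. A state $\phi\in\mathcal S(\mathcal H)$ is *maximally resourceful* if $\psi\succeq\phi$ implies $\phi\succeq\psi$ for all $\psi\in\mathcal S(\mathcal H)$; it is *free* if for every system $\mathcal H'$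 and every $\rho\in\mathcal S(\mathcal H')$ there is $\mathcal N\in\mathcal O(\mathcal H'\to\mathcal H)$ with $\mathcal N(\rho)=\phi$. The *asymptotic conversion rate* is $$r_{\mathrm{conv}}(\phi\to\psi)=\sup\Big\{r\ge 0:\exists\,\mathcal N_n\in\mathcal O\big(\mathcal H^{\otimes n}\to\mathcal H^{\otimes\lceil rn\rceil}\big)\ (n\in\mathbb N),\ \liminf_{n\to\infty}\big\|\mathcal N_n(\phi^{\otimes n})-\psi^{\otimes\lceil rn\rceil}\big\|_1=0\Big\}\in[0,\infty].$$ A *resource measure* is a family of functions $R_{\mathcal H}:\mathcal S(\mathcal H)\to\mathbb R$, one for each system, such that $R_{\mathcal H'}(\mathcal N(\psi))\le R_{\mathcal H}(\psi)$ for all systems $\mathcal H,\mathcal H'$, all $\psi\in\mathcal S(\mathcal H)$ and all $\mathcal N\in\mathcal O(\mathcal H\to\mathcal H')$. Given normalization constants $R_{\max}^{(\mathcal H)}$, the measure $R$ is, on a system $\mathcal H$, * *conventionally normalized* if $R_{\mathcal H}(\sigma)=0$ for every free state $\sigma\in\mathcal S(\mathcal H)$ and $R_{\mathcal H}(\phi)=R_{\max}^{(\mathcal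 H)}$ for every maximally resourceful $\phi\in\mathcal S(\mathcal H)$; * *asymptotically continuous* if for all positive integers $n_i$ $(i\in\mathbb N)$ and all states $\phi_i,\psi_i\in\mathcal S(\mathcal H^{\otimes n_i})$ with $\lim_{i\to\infty}\|\phi_i-\psi_i\|_1=0$ one has $\lim_{i\to\infty}\frac{|R_{\mathcal H^{\otimes n_i}}(\phi_i)-R_{\mathcal H^{\otimes n_i}}(\psi_i)|}{n_i}=0$; * *weakly additive* if $R_{\mathcal H^{\otimes n}}(\psi^{\otimes n})=n\,R_{\mathcal H}(\psi)$ for every $\psi\in\mathcal S(\mathcal H)$ and every integer $n\ge1$. **Theorem (Inconsistency of Conventional Properties of Resource Measure).** Let $\mathcal H$ be a system with $R_{\max}^{(\mathcal H)}>0$, and suppose that there are maximally resourceful states $\phi_0,\phi_1\in\mathcal S(\mathcal H)$ with $r_{\mathrm{conv}}(\phi_0\to\phi_1)>1$. Then there is no resource measure that is simultaneously conventionally normalized, asymptotically continuous and weakly additive on $\mathcal H$; in particular, none has these three properties on all systems. -/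

import Mathlib

open Filter Topology
open scoped ENNReal NNReal InnerProductSpace TensorProduct CStarAlgebra

noncomputable section

set_option linter.unusedSectionVars false
set_option linter.checkUnivs false

namespace ResourceTheory

universe u v

/-! ## Trace, trace norm, density operators -/

section Trace

variable (H : Type*) [NormedAddCommGroup H] [InnerProductSpace ℂ H] [CompleteSpace H]

/-- The index type of a fixed orthonormal basis of the Hilbert space `H`. -/
def OnbIndex : Type _ := ↥(exists_hilbertBasis ℂ H).choose

/-- A fixed orthonormal basis (complete orthonormal system) of `H`. The trace and the trace norm
do not depend on it. -/
def onb : HilbertBasis (OnbIndex H) ℂ H := (exists_hilbertBasis ℂ H).choose_spec.choose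

variable {H}

/-- The trace `∑ₖ ⟨k|T|k⟩` (meaningful for trace-class `T`). -/
def trace (T : H →L[ℂ] H) : ℂ := ∑' k, ⟪onb H k, T (onb H k)⟫_ℂ

/-- The trace `∑ₖ ⟨k|T|k⟩ ∈ [0, ∞]` of a positive operator `T`. -/
def posTrace (T : H →L[ℂ] H) : ℝ≥0∞ :=
  ∑' k, ENNReal.ofReal (RCLike.re ⟪onb H k, T (onb H k)⟫_ℂ)

/-- The trace norm `‖T‖₁ = tr |T|`, with `|T| = √(T† T)`; it is `∞` when `T` is not
trace-class. -/
def traceNorm (T : H →L[ℂ] H) : ℝ≥0∞ := posTrace (CFC.abs T)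

/-- Trace-class operators. -/
def IsTraceClass (T : H →L[ℂ] H) : Prop := traceNorm T < ∞

lemma tsum_inner_sq_eq {ι : Type*} (b : HilbertBasis ι ℂ H) (x : H) :
    ∑' i, ENNReal.ofReal (‖⟪b i, x⟫_ℂ‖ ^ 2) = ENNReal.ofReal (‖x‖ ^ 2) := by
  have h := (b.hasSum_inner_mul_inner x x).mapL Complex.reCLM
  have h2 : HasSum (fun i => ‖⟪b i, x⟫_ℂ‖ ^ 2) (‖x‖ ^ 2) := by
    have e1 : ∀ i, ‖⟪b i, x⟫_ℂ‖ ^ 2 = Complex.reCLM (⟪x, b i⟫_ℂ * ⟪b i, x⟫_ℂ) := fun i => by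
      rw [← inner_conj_symm x (b i), mul_comm, Complex.mul_conj, Complex.normSq_eq_norm_sq,
        Complex.reCLM_apply, Complex.ofReal_re]
    have e2 : ‖x‖ ^ 2 = Complex.reCLM ⟪x, x⟫_ℂ := norm_sq_eq_re_inner (𝕜 := ℂ) x
    rw [e2]
    exact h.congr_fun e1
  rw [← h2.tsum_eq, ENNReal.ofReal_tsum_of_nonneg (fun i => by positivity) h2.summable]

lemma sum_norm_sq_comm {K : Type*} [NormedAddCommGroup K] [InnerProductSpace ℂ K]
    [CompleteSpace K] {ι κ : Type*} (b : HilbertBasis ι ℂ H) (c : HilbertBasis κ ℂ K)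
    (S : H →L[ℂ] K) :
    ∑' i, ENNReal.ofReal (‖S (b i)‖ ^ 2) =
      ∑' j, ENNReal.ofReal (‖ContinuousLinearMap.adjoint S (c j)‖ ^ 2) := by
  simp_rw [← tsum_inner_sq_eq c, ← tsum_inner_sq_eq b]
  rw [ENNReal.tsum_comm]
  refine tsum_congr fun j => tsum_congr fun i => ?_
  rw [ContinuousLinearMap.adjoint_inner_right, ← inner_conj_symm, RCLike.norm_conj]

lemma re_inner_eq_of_nonneg {T : H →L[ℂ] H} (hT : 0 ≤ T) (x : H) :
    RCLike.re ⟪x, T x⟫_ℂ = ‖CFC.sqrt T x‖ ^ 2 := by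
  have h1 : CFC.sqrt T * CFC.sqrt T = T := CFC.sqrt_mul_sqrt_self T hT
  have h2 : ContinuousLinearMap.adjoint (CFC.sqrt T) = CFC.sqrt T :=
    (CFC.sqrt_nonneg T).isSelfAdjoint
  conv_lhs => rw [← h1]
  rw [mul_apply_eq_comp, ← ContinuousLinearMap.adjoint_inner_left, h2,
    ← norm_sq_eq_re_inner (𝕜 := ℂ)]

/-- The trace of a positive operator does not depend on the orthonormal basis. -/
lemma posTrace_eq {T : H →L[ℂ] H} (hT : 0 ≤ T) {ι : Type*} (b : HilbertBasis ι ℂ H) :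
    posTrace T = ∑' i, ENNReal.ofReal (RCLike.re ⟪b i, T (b i)⟫_ℂ) := by
  unfold posTrace
  simp_rw [re_inner_eq_of_nonneg hT]
  rw [sum_norm_sq_comm (onb H) b]
  rw [(CFC.sqrt_nonneg T).isSelfAdjoint.adjoint_eq]

lemma posTrace_eq_one_iff {T : H →L[ℂ] H} (hT : 0 ≤ T) :
    posTrace T = 1 ↔ IsTraceClass T ∧ trace T = 1 := by
  have hnn : ∀ k, 0 ≤ RCLike.re ⟪onb H k, T (onb H k)⟫_ℂ := fun k => by
    rw [re_inner_eq_of_nonneg hT]; positivity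
  have him : ∀ k, ⟪onb H k, T (onb H k)⟫_ℂ =
      ((RCLike.re ⟪onb H k, T (onb H k)⟫_ℂ : ℝ) : ℂ) := fun k => by
    have h := ((ContinuousLinearMap.nonneg_iff_isPositive T).1 hT).inner_nonneg_right (onb H k)
    rw [Complex.le_def] at h
    apply Complex.ext
    · simp
    · simpa using h.2.symm
  have habs : traceNorm T = posTrace T := by
    rw [traceNorm, CFC.abs_of_nonneg T hT]
  have htr : trace T = ((∑' k, RCLike.re ⟪onb H k, T (onb H k)⟫_ℂ : ℝ) : ℂ) := by
    rw [trace, Complex.ofReal_tsum]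
    exact tsum_congr him
  have key : IsTraceClass T →
      ENNReal.ofReal (∑' k, RCLike.re ⟪onb H k, T (onb H k)⟫_ℂ) = posTrace T := by
    intro h
    rw [IsTraceClass, habs] at h
    have hs : Summable fun k => RCLike.re ⟪onb H k, T (onb H k)⟫_ℂ := by
      have := ENNReal.summable_toReal h.ne
      refine this.congr fun k => ?_
      exact ENNReal.toReal_ofReal (hnn k)
    rw [ENNReal.ofReal_tsum_of_nonneg hnn hs, posTrace]
  constructor
  · intro h
    have htc : IsTraceClass T := by rw [IsTraceClass, habs, h]; exact ENNReal.one_lt_top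
    refine ⟨htc, ?_⟩
    have := key htc
    rw [h, ENNReal.ofReal_eq_one] at this
    rw [htr, this, Complex.ofReal_one]
  · rintro ⟨htc, h⟩
    rw [← key htc]
    rw [htr] at h
    have h' : (∑' k, RCLike.re ⟪onb H k, T (onb H k)⟫_ℂ) = 1 := by exact_mod_cast h
    rw [h', ENNReal.ofReal_one]

end Trace

/-- Density operators on `H`: positive trace-class operators of trace one. -/
structure Density (H : Type*) [NormedAddCommGroup H] [InnerProductSpace ℂ H]
    [CompleteSpace H] where
  op : H →L[ℂ] H
  nonneg : 0 ≤ op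
  traceClass : IsTraceClass op
  trace_eq_one : trace op = 1


section DensityOps

variable {H K : Type*} [NormedAddCommGroup H] [InnerProductSpace ℂ H] [CompleteSpace H]
  [NormedAddCommGroup K] [InnerProductSpace ℂ K] [CompleteSpace K]

lemma Density.ext {ρ σ : Density H} (h : ρ.op = σ.op) : ρ = σ := by
  cases ρ; cases σ; congr

/-- Trace distance (without the factor `1/2`): `‖ρ - σ‖₁`. -/
def Density.dist (ρ σ : Density H) : ℝ≥0∞ := traceNorm (ρ.op - σ.op)

/-- The trace norm topology on density operators, generated by the open trace norm balls. -/
instance : TopologicalSpace (Density H) :=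
  TopologicalSpace.generateFrom
    {U | ∃ (ρ : Density H) (ε : ℝ≥0∞), U = {σ | Density.dist σ ρ < ε}}

/-- A positive operator of trace one as a density operator. -/
def Density.mk' (T : H →L[ℂ] H) (hT : 0 ≤ T) (h : posTrace T = 1) : Density H :=
  ⟨T, hT, ((posTrace_eq_one_iff hT).1 h).1, ((posTrace_eq_one_iff hT).1 h).2⟩

lemma Density.posTrace_op (ρ : Density H) : posTrace ρ.op = 1 :=
  (posTrace_eq_one_iff ρ.nonneg).2 ⟨ρ.traceClass, ρ.trace_eq_one⟩

/-- The image of a Hilbert basis under a unitary. -/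
def mapBasis {ι : Type*} (b : HilbertBasis ι ℂ H) (U : H ≃ₗᵢ[ℂ] K) : HilbertBasis ι ℂ K :=
  HilbertBasis.ofRepr (U.symm.trans b.repr)

lemma mapBasis_apply {ι : Type*} (b : HilbertBasis ι ℂ H) (U : H ≃ₗᵢ[ℂ] K) (i : ι) :
    mapBasis b U i = U (b i) := by
  classical
  rw [← HilbertBasis.repr_symm_single, ← HilbertBasis.repr_symm_single]
  rfl

/-- `U T U⁻¹` for a unitary `U : H → K`. -/
def conjOp (U : H ≃ₗᵢ[ℂ] K) (T : H →L[ℂ] H) : K →L[ℂ] K :=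
  (U : H →L[ℂ] K) ∘L T ∘L (U.symm : K →L[ℂ] H)

lemma conjOp_nonneg (U : H ≃ₗᵢ[ℂ] K) {T : H →L[ℂ] H} (hT : 0 ≤ T) : 0 ≤ conjOp U T := by
  rw [ContinuousLinearMap.nonneg_iff_isPositive]
  have h := ((ContinuousLinearMap.nonneg_iff_isPositive T).1 hT).conj_adjoint (U : H →L[ℂ] K)
  rwa [LinearIsometryEquiv.adjoint_eq_symm] at h

/-- Transport of a density operator along a unitary: `ρ ↦ U ρ U⁻¹`. -/
def Density.map (U : H ≃ₗᵢ[ℂ] K) (ρ : Density H) : Density K :=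
  Density.mk' (conjOp U ρ.op) (conjOp_nonneg U ρ.nonneg) (by
    rw [posTrace_eq (conjOp_nonneg U ρ.nonneg) (mapBasis (onb H) U), ← ρ.posTrace_op]
    refine tsum_congr fun i => ?_
    rw [mapBasis_apply]
    simp [conjOp])

/-- The unique density operator `1` on `ℂ`. -/
def Density.one : Density ℂ :=
  Density.mk' 1 zero_le_one (by
    rw [posTrace_eq zero_le_one (OrthonormalBasis.singleton Unit ℂ).toHilbertBasis]
    simp)

/-! ## Tensor products -/

variable (H K) in
/-- The Hilbert space tensor product: the completion of the algebraic tensor product with the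
inner product `⟪x ⊗ y, x' ⊗ y'⟫ = ⟪x, x'⟫ ⟪y, y'⟫`. -/
abbrev HTensor : Type _ := UniformSpace.Completion (H ⊗[ℂ] K)

/-- The bounded operator `S ⊗ T` with `(S ⊗ T) (x ⊗ y) = S x ⊗ T y`. -/
def opTensor (S : H →L[ℂ] H) (T : K →L[ℂ] K) : HTensor H K →L[ℂ] HTensor H K :=
  (TensorProduct.mapL S T).completion

lemma opTensor_coe (S : H →L[ℂ] H) (T : K →L[ℂ] K) (x : H ⊗[ℂ] K) :
    opTensor S T (x : HTensor H K) = (TensorProduct.mapL S T x : H ⊗[ℂ] K) := by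
  simp [opTensor]

lemma inner_mapL_adjoint (S : H →L[ℂ] H) (T : K →L[ℂ] K) (x y : H ⊗[ℂ] K) :
    ⟪TensorProduct.mapL S T x, y⟫_ℂ = ⟪x, TensorProduct.mapL (ContinuousLinearMap.adjoint S)
      (ContinuousLinearMap.adjoint T) y⟫_ℂ := by
  induction x using TensorProduct.induction_on with
  | zero => simp
  | add a b ha hb => rw [map_add, inner_add_left, inner_add_left, ha, hb]
  | tmul a b =>
    induction y using TensorProduct.induction_on with
    | zero => simp
    | add c d hc hd => rw [map_add, inner_add_right, inner_add_right, hc, hd]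
    | tmul c d =>
      rw [TensorProduct.mapL_tmul, TensorProduct.mapL_tmul, TensorProduct.inner_tmul,
        TensorProduct.inner_tmul, ContinuousLinearMap.adjoint_inner_right,
        ContinuousLinearMap.adjoint_inner_right]

lemma adjoint_opTensor (S : H →L[ℂ] H) (T : K →L[ℂ] K) :
    ContinuousLinearMap.adjoint (opTensor S T) =
      opTensor (ContinuousLinearMap.adjoint S) (ContinuousLinearMap.adjoint T) := by
  symm
  rw [ContinuousLinearMap.eq_adjoint_iff]
  intro x y
  induction x, y using UniformSpace.Completion.induction_on₂ with
  | hp => exact isClosed_eq (by fun_prop) (by fun_prop)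
  | ih a b =>
    rw [opTensor_coe, opTensor_coe, UniformSpace.Completion.inner_coe,
      UniformSpace.Completion.inner_coe, inner_mapL_adjoint]
    simp only [ContinuousLinearMap.adjoint_adjoint]

lemma opTensor_mul (S S' : H →L[ℂ] H) (T T' : K →L[ℂ] K) :
    opTensor (S * S') (T * T') = opTensor S T * opTensor S' T' := by
  ext x
  induction x using UniformSpace.Completion.induction_on with
  | hp => exact isClosed_eq (by fun_prop) (by fun_prop)
  | ih a =>
    rw [mul_apply_eq_comp, opTensor_coe, opTensor_coe, opTensor_coe, TensorProduct.mapL_mul]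
    rfl

lemma opTensor_nonneg {S : H →L[ℂ] H} {T : K →L[ℂ] K} (hS : 0 ≤ S) (hT : 0 ≤ T) :
    0 ≤ opTensor S T := by
  have h1 : CFC.sqrt S * CFC.sqrt S = S := CFC.sqrt_mul_sqrt_self S hS
  have h2 : CFC.sqrt T * CFC.sqrt T = T := CFC.sqrt_mul_sqrt_self T hT
  have h : opTensor S T = star (opTensor (CFC.sqrt S) (CFC.sqrt T)) *
      opTensor (CFC.sqrt S) (CFC.sqrt T) := by
    rw [ContinuousLinearMap.star_eq_adjoint, adjoint_opTensor,
      (CFC.sqrt_nonneg S).isSelfAdjoint.adjoint_eq, (CFC.sqrt_nonneg T).isSelfAdjoint.adjoint_eq,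
      ← opTensor_mul, h1, h2]
  rw [h]
  exact star_mul_self_nonneg (opTensor (CFC.sqrt S) (CFC.sqrt T))

/-- The product of two orthonormal bases is an orthonormal basis. -/
lemma exists_tensorBasis {ι κ : Type*} (b : HilbertBasis ι ℂ H) (c : HilbertBasis κ ℂ K) :
    ∃ d : HilbertBasis (ι × κ) ℂ (HTensor H K),
      ∀ p, d p = ((b p.1 ⊗ₜ[ℂ] c p.2 : H ⊗[ℂ] K) : HTensor H K) := by
  classical
  let v : ι × κ → HTensor H K := fun p => ((b p.1 ⊗ₜ[ℂ] c p.2 : H ⊗[ℂ] K) : HTensor H K)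
  have hv : Orthonormal ℂ v := by
    rw [orthonormal_iff_ite]
    rintro ⟨i, j⟩ ⟨i', j'⟩
    simp only [v, UniformSpace.Completion.inner_coe, TensorProduct.inner_tmul,
      orthonormal_iff_ite.1 b.orthonormal, orthonormal_iff_ite.1 c.orthonormal, Prod.mk.injEq]
    split_ifs <;> simp_all
  have hsp : ⊤ ≤ (Submodule.span ℂ (Set.range v)).topologicalClosure := by
    set M := (Submodule.span ℂ (Set.range v)).topologicalClosure with hM
    have hMc : IsClosed (M : Set (HTensor H K)) := Submodule.isClosed_topologicalClosure _
    let f : H → K →L[ℂ] HTensor H K := fun x =>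
      UniformSpace.Completion.toComplL ∘L (TensorProduct.mkL ℂ H K x)
    let g : K → H →L[ℂ] HTensor H K := fun y =>
      UniformSpace.Completion.toComplL ∘L ((TensorProduct.mkL ℂ H K).flip y)
    have h1 : ∀ x j, ((x ⊗ₜ[ℂ] c j : H ⊗[ℂ] K) : HTensor H K) ∈ M := by
      intro x j
      have : (Submodule.span ℂ (Set.range b)).topologicalClosure ≤
          M.comap (g (c j)).toLinearMap := by
        refine Submodule.topologicalClosure_minimal _ ?_ (hMc.preimage (g (c j)).continuous)
        rw [Submodule.span_le]
        rintro _ ⟨i, rfl⟩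
        exact Submodule.le_topologicalClosure _ (Submodule.subset_span ⟨(i, j), rfl⟩)
      rw [b.dense_span] at this
      exact this (Submodule.mem_top (x := x))
    have h2 : ∀ x y, ((x ⊗ₜ[ℂ] y : H ⊗[ℂ] K) : HTensor H K) ∈ M := by
      intro x y
      have : (Submodule.span ℂ (Set.range c)).topologicalClosure ≤
          M.comap (f x).toLinearMap := by
        refine Submodule.topologicalClosure_minimal _ ?_ (hMc.preimage (f x).continuous)
        rw [Submodule.span_le]
        rintro _ ⟨j, rfl⟩
        exact h1 x j
      rw [c.dense_span] at this
      exact this (Submodule.mem_top (x := y))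
    intro z hz
    clear hz
    induction z using UniformSpace.Completion.induction_on with
    | hp => exact hMc
    | ih a =>
      induction a using TensorProduct.induction_on with
      | zero => exact M.zero_mem
      | tmul x y => exact h2 x y
      | add a a' ha ha' =>
        rw [UniformSpace.Completion.coe_add]
        exact M.add_mem ha ha'
  exact ⟨HilbertBasis.mk hv hsp, fun p => by rw [HilbertBasis.coe_mk]⟩

/-- The product state `ρ ⊗ σ`. -/
def Density.tensor (ρ : Density H) (σ : Density K) : Density (HTensor H K) :=
  Density.mk' (opTensor ρ.op σ.op) (opTensor_nonneg ρ.nonneg σ.nonneg) (by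
    obtain ⟨d, hd⟩ := exists_tensorBasis (onb H) (onb K)
    rw [posTrace_eq (opTensor_nonneg ρ.nonneg σ.nonneg) d, ENNReal.tsum_prod']
    have hre : ∀ i j, ENNReal.ofReal (RCLike.re ⟪d (i, j), opTensor ρ.op σ.op (d (i, j))⟫_ℂ) =
        ENNReal.ofReal (RCLike.re ⟪onb H i, ρ.op (onb H i)⟫_ℂ) *
          ENNReal.ofReal (RCLike.re ⟪onb K j, σ.op (onb K j)⟫_ℂ) := by
      intro i j
      have h1 := ((ContinuousLinearMap.nonneg_iff_isPositive _).1 ρ.nonneg).inner_nonneg_right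
        (onb H i)
      have h2 := ((ContinuousLinearMap.nonneg_iff_isPositive _).1 σ.nonneg).inner_nonneg_right
        (onb K j)
      rw [Complex.le_def] at h1 h2
      rw [hd, opTensor_coe, UniformSpace.Completion.inner_coe, TensorProduct.mapL_tmul,
        TensorProduct.inner_tmul, ← ENNReal.ofReal_mul (by simpa using h1.1)]
      congr 1
      have h3 := h1.2
      simp only [Complex.zero_im] at h3
      simp [← h3]
    simp_rw [hre, ENNReal.tsum_mul_left]
    have h1 := ρ.posTrace_op
    have h2 := σ.posTrace_op
    unfold posTrace at h1 h2
    rw [h2]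
    simp only [mul_one]
    exact h1)

end DensityOps

/-! ## Channels -/

/-- A quantum channel from `H` to `K`: the map `toFun` of states (Schrödinger picture), together
with the dual map `dual` of bounded operators (Heisenberg picture), which is linear, completely
positive and unital; the two are related by `tr (E(ρ) M) = tr (ρ E†(M))`. Each of the two maps
determines the other, and the duality makes `dual` normal. -/
structure Channel (H K : Type*) [NormedAddCommGroup H] [InnerProductSpace ℂ H] [CompleteSpace H]
    [NormedAddCommGroup K] [InnerProductSpace ℂ K] [CompleteSpace K] where
  toFun : Density H → Density K
  dual : (K →L[ℂ] K) →CP (H →L[ℂ] H)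
  dual_one : dual 1 = 1
  trace_toFun_mul : ∀ (ρ : Density H) (M : K →L[ℂ] K),
    trace ((toFun ρ).op * M) = trace (ρ.op * dual M)

namespace Channel

variable {H K L : Type*} [NormedAddCommGroup H] [InnerProductSpace ℂ H] [CompleteSpace H]
  [NormedAddCommGroup K] [InnerProductSpace ℂ K] [CompleteSpace K]
  [NormedAddCommGroup L] [InnerProductSpace ℂ L] [CompleteSpace L]

instance : CoeFun (Channel H K) (fun _ => Density H → Density K) := ⟨toFun⟩

variable (H) in
/-- The identity channel. -/
def id : Channel H H where
  toFun ρ := ρ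
  dual := { (LinearMap.id : (H →L[ℂ] H) →ₗ[ℂ] (H →L[ℂ] H)) with
    map_cstarMatrix_nonneg' := fun _ _ hM => hM }
  dual_one := rfl
  trace_toFun_mul _ _ := rfl

/-- The composition `N ∘ M`. -/
def comp (N : Channel K L) (M : Channel H K) : Channel H L where
  toFun ρ := N (M ρ)
  dual := { M.dual.toLinearMap ∘ₗ N.dual.toLinearMap with
    map_cstarMatrix_nonneg' := fun k A hA =>
      M.dual.map_cstarMatrix_nonneg' k _ (N.dual.map_cstarMatrix_nonneg' k A hA) }
  dual_one := by
    change M.dual (N.dual 1) = 1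
    rw [N.dual_one, M.dual_one]
  trace_toFun_mul ρ A := by
    rw [N.trace_toFun_mul, M.trace_toFun_mul]
    rfl

/-- The bounded weak topology: the weakest topology for which `E ↦ tr (E(ρ) M)` is continuous for
all states `ρ` (these span the predual) and all bounded operators `M`. -/
instance : TopologicalSpace (Channel H K) :=
  ⨅ (ρ : Density H) (M : K →L[ℂ] K),
    TopologicalSpace.induced (fun E : Channel H K => trace ((E ρ).op * M)) inferInstance

end Channel

/-! ## Quantum resource theories -/

/-- A collection of quantum systems. Each system has a complex Hilbert space (two systems may share
the same Hilbert space, as when a system carries the additional data of a partition into parties);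
the collection contains `ℂ` and is closed under tensor products. -/
structure QuantumSystems where
  Sys : Type v
  space : Sys → Type u
  [normedAddCommGroup : ∀ A, NormedAddCommGroup (space A)]
  [innerProductSpace : ∀ A, InnerProductSpace ℂ (space A)]
  [completeSpace : ∀ A, CompleteSpace (space A)]
  unit : Sys
  unitIso : ℂ ≃ₗᵢ[ℂ] space unit
  tensor : Sys → Sys → Sys
  tensorIso : ∀ A B, HTensor (space A) (space B) ≃ₗᵢ[ℂ] space (tensor A B)

attribute [instance] QuantumSystems.normedAddCommGroup QuantumSystems.innerProductSpace
  QuantumSystems.completeSpace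

namespace QuantumSystems

variable (Q : QuantumSystems.{u, v})

/-- The density operator `1` of the trivial system `ℂ`. -/
def unitState : Density (Q.space Q.unit) := Density.one.map Q.unitIso

/-- The product state `ρ ⊗ σ` of the composite system. -/
def prodState {A B : Q.Sys} (ρ : Density (Q.space A)) (σ : Density (Q.space B)) :
    Density (Q.space (Q.tensor A B)) :=
  (ρ.tensor σ).map (Q.tensorIso A B)

/-- The system `H^{⊗n}`, with `H^{⊗0} = ℂ` and `H^{⊗1} = H`. -/
def pow (A : Q.Sys) : ℕ → Q.Sys
  | 0 => Q.unit
  | 1 => A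
  | n + 2 => Q.tensor (pow A (n + 1)) A

/-- The state `ρ^{⊗n}` of `H^{⊗n}`, with `ρ^{⊗0} = 1` and `ρ^{⊗1} = ρ`. -/
def powState {A : Q.Sys} (ρ : Density (Q.space A)) : (n : ℕ) → Density (Q.space (Q.pow A n))
  | 0 => Q.unitState
  | 1 => ρ
  | n + 2 => Q.prodState (powState ρ (n + 1)) ρ

end QuantumSystems

/-- A quantum resource theory: for each system a compact set `S` of density operators (the states
of interest), and for each pair of systems a compact set `O` of channels (the free operations)
mapping states of interest to states of interest. -/
structure QRT extends QuantumSystems.{u, v} where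
  S : ∀ A, Set (Density (space A))
  isCompact_S : ∀ A, IsCompact (S A)
  unitState_mem : toQuantumSystems.unitState ∈ S unit
  prodState_mem : ∀ {A B}, ∀ ρ ∈ S A, ∀ σ ∈ S B, toQuantumSystems.prodState ρ σ ∈ S (tensor A B)
  O : ∀ A B, Set (Channel (space A) (space B))
  isCompact_O : ∀ A B, IsCompact (O A B)
  map_mem : ∀ {A B}, ∀ N ∈ O A B, ∀ ρ ∈ S A, N ρ ∈ S B
  /-- Compositions of free operations are free. -/
  comp_mem : ∀ {A B C}, ∀ M ∈ O A B, ∀ N ∈ O B C, N.comp M ∈ O A C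
  /-- The tensor product `M ⊗ N`, i.e. the channel `L` with `L(ρ ⊗ σ) = M(ρ) ⊗ N(σ)`, of free
  operations is free. -/
  tensor_mem : ∀ {A₁ B₁ A₂ B₂}, ∀ M ∈ O A₁ B₁, ∀ N ∈ O A₂ B₂,
    ∃ L ∈ O (tensor A₁ A₂) (tensor B₁ B₂), ∀ ρ σ,
      L (toQuantumSystems.prodState ρ σ) = toQuantumSystems.prodState (M ρ) (N σ)
  /-- The identity is free. -/
  id_mem : ∀ A, Channel.id (space A) ∈ O A A
  /-- The trace, i.e. the channel to `ℂ` mapping every density operator to `1`, is free. -/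
  trace_mem : ∀ A, ∃ T ∈ O A unit, ∀ ρ, T ρ = toQuantumSystems.unitState

namespace QRT

variable (Q : QRT.{u, v})

/-- The set `S(H)` of states, as a type. -/
abbrev State (A : Q.Sys) : Type u := ↥(Q.S A)

variable {Q}

/-- The action of a free operation on states. -/
def apply {A B : Q.Sys} (N : Q.O A B) (ψ : Q.State A) : Q.State B :=
  ⟨N.1 ψ.1, Q.map_mem N.1 N.2 ψ.1 ψ.2⟩

lemma powState_mem {A : Q.Sys} {ρ : Density (Q.space A)} (hρ : ρ ∈ Q.S A) :
    ∀ n, Q.powState ρ n ∈ Q.S (Q.pow A n)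
  | 0 => Q.unitState_mem
  | 1 => hρ
  | n + 2 => Q.prodState_mem _ (powState_mem hρ (n + 1)) _ hρ

/-- The state `ψ^{⊗n}`. -/
def statePow {A : Q.Sys} (ψ : Q.State A) (n : ℕ) : Q.State (Q.pow A n) :=
  ⟨Q.powState ψ.1 n, powState_mem ψ.2 n⟩

/-- The preorder `φ ⪰ ψ`: some free operation maps `φ` to `ψ`. -/
def Converts {A : Q.Sys} (φ ψ : Q.State A) : Prop := ∃ N : Q.O A A, apply N φ = ψ

/-- Maximally resourceful states, the maximal elements of the preorder. -/
def IsMaximal {A : Q.Sys} (φ : Q.State A) : Prop :=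
  ∀ ψ : Q.State A, Converts ψ φ → Converts φ ψ

/-- Free states: those which free operations can generate from any state of any system. -/
def IsFree {A : Q.Sys} (ψ : Q.State A) : Prop :=
  ∀ (B : Q.Sys) (φ : Q.State B), ∃ N : Q.O B A, ψ = apply N φ

/-- The achievable rates of asymptotic conversion from `φ` to `ψ`: the `r ≥ 0` for which free
operations `N n` from `n` copies to `⌈r n⌉` copies satisfy
`liminf ‖N n (φ^{⊗n}) - ψ^{⊗⌈r n⌉}‖₁ = 0`. -/
def achievableRates {A B : Q.Sys} (φ : Q.State A) (ψ : Q.State B) : Set ℝ≥0 :=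
  {r | ∃ N : ∀ n : ℕ, Q.O (Q.pow A n) (Q.pow B ⌈r * n⌉₊),
    liminf (fun n : ℕ =>
      Density.dist (apply (N n) (statePow φ n)).1 (statePow ψ ⌈r * n⌉₊).1) atTop = 0}

/-- The asymptotic conversion rate `r_conv(φ → ψ) ∈ [0, ∞]`. -/
def rConv {A B : Q.Sys} (φ : Q.State A) (ψ : Q.State B) : ℝ≥0∞ :=
  ⨆ r ∈ achievableRates φ ψ, (r : ℝ≥0∞)

variable (Q) in
/-- A resource measure: a family of real functions on the states of all systems that is monotone
under free operations. -/
structure ResourceMeasure where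
  toFun : ∀ A : Q.Sys, Q.State A → ℝ
  monotone : ∀ {A B : Q.Sys} (N : Q.O A B) (ψ : Q.State A), toFun B (apply N ψ) ≤ toFun A ψ

namespace ResourceMeasure

variable (R : ResourceMeasure Q) (A : Q.Sys)

/-- Conventional normalization on the system `A`, with normalization constant `Rmax`. -/
def IsConventionallyNormalizedOn (Rmax : ℝ) : Prop :=
  (∀ σ : Q.State A, IsFree σ → R.toFun A σ = 0) ∧
    ∀ φ : Q.State A, IsMaximal φ → R.toFun A φ = Rmax

/-- Asymptotic continuity on the system `A`. -/
def IsAsymptoticallyContinuousOn : Prop :=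
  ∀ (n : ℕ → ℕ), (∀ i, 0 < n i) → ∀ φ ψ : ∀ i, Q.State (Q.pow A (n i)),
    Tendsto (fun i => Density.dist (φ i).1 (ψ i).1) atTop (𝓝 0) →
      Tendsto (fun i => |R.toFun _ (φ i) - R.toFun _ (ψ i)| / (n i : ℝ)) atTop (𝓝 0)

/-- Weak additivity on the system `A`. -/
def IsWeaklyAdditiveOn : Prop :=
  ∀ (ψ : Q.State A) (n : ℕ), 0 < n → R.toFun _ (statePow ψ n) = n * R.toFun A ψ

end ResourceMeasure

end QRT

end ResourceTheory

end

/-! The three axioms force the regularized measure to bound conversion rates, while normalization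
gives all maximally resourceful states the same value. If n copies of φ become nearly m = ⌈rn⌉
copies of ψ, monotonicity and weak additivity bound the measure of the output by n R(φ), and
asymptotic continuity says that this measure is m R(ψ) up to an error o(1) · m. Dividing by m ≥ rn
gives r R(ψ) ≤ R(φ); this is `ResourceMeasure.rate_mul_le`. For φ₀ and φ₁ both values are `Rmax A` >
0, so no rate r > 1 is achievable, contrary to r_conv(φ₀ → φ₁) > 1. The limit inferior in the
definition of the rate supplies small errors only for some n;
`exists_pos_seq_tendsto_zero_of_liminf_eq_zero` extracts these n, which need not be increasing or
unbounded. -/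

/-- A sequence of extended nonnegative reals with vanishing limit inferior has terms of positive
index converging to zero. -/
theorem exists_pos_seq_tendsto_zero_of_liminf_eq_zero {f : ℕ → ℝ≥0∞}
    (hf : liminf f atTop = 0) :
    ∃ n : ℕ → ℕ, (∀ i, 0 < n i) ∧ Tendsto (fun i => f (n i)) atTop (𝓝 0) := by
  -- At i = 0 the bound is ∞, since 0⁻¹ = ∞ in `ℝ≥0∞`, so no shift of the index is needed. The bound
  -- holds frequently, hence also at some n > 0.
  have key : ∀ i : ℕ, ∃ n, f n < ((i : ℝ≥0∞))⁻¹ ∧ 0 < n := fun i =>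
    ((frequently_lt_of_liminf_lt (by isBoundedDefault)
      (hf ▸ ENNReal.inv_pos.2 (ENNReal.natCast_ne_top i))).and_eventually
      (eventually_gt_atTop 0)).exists
  choose n hlt hpos using key
  exact ⟨n, hpos, tendsto_of_tendsto_of_tendsto_of_le_of_le tendsto_const_nhds
    ENNReal.tendsto_inv_nat_nhds_zero (fun _ => zero_le) fun i => (hlt i).le⟩

namespace ResourceTheory.QRT

/-- A weakly additive, asymptotically continuous resource measure bounds conversion rates:
`r R(ψ) ≤ R(φ)` for every achievable rate `r > 0` from `φ` to a state `ψ` with `R(ψ) > 0`. -/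
theorem ResourceMeasure.rate_mul_le {Q : QRT} (R : Q.ResourceMeasure) {A B : Q.Sys}
    (hA : R.IsWeaklyAdditiveOn A) (hB : R.IsWeaklyAdditiveOn B)
    (hcont : R.IsAsymptoticallyContinuousOn B) {φ : Q.State A} {ψ : Q.State B}
    (hpos : 0 < R.toFun B ψ) {r : ℝ≥0} (hr : 0 < r) (hmem : r ∈ achievableRates φ ψ) :
    r * R.toFun B ψ ≤ R.toFun A φ := by
  obtain ⟨N, hN⟩ := hmem
  obtain ⟨n, hn, hlim⟩ := exists_pos_seq_tendsto_zero_of_liminf_eq_zero hN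
  -- Asymptotic continuity and weak additivity both require a positive number of copies; this is
  -- where r > 0 and n i > 0 enter.
  have hm : ∀ i, 0 < ⌈r * n i⌉₊ := fun i =>
    Nat.ceil_pos.2 (mul_pos hr (Nat.cast_pos.2 (hn i)))
  -- The compared states live on the output powers of B, so the error is measured per output copy.
  have hzero := hcont (fun i => ⌈r * n i⌉₊) hm (fun i => apply (N (n i)) (statePow φ (n i)))
    (fun i => statePow ψ ⌈r * n i⌉₊) hlim
  have hr' : (0 : ℝ) < r := hr
  by_contra! hlt
  replace hpos := mul_pos hr' hpos
  -- The threshold is the gap between R(ψ) and the largest value per output copy, max(R(φ), 0)/r,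
  -- that monotonicity allows. It is positive because r R(ψ) exceeds both R(φ) and 0. A single index
  -- with error below the gap suffices for the contradiction.
  obtain ⟨i, hi⟩ := (hzero.eventually_lt_const
    (u := R.toFun B ψ - max (R.toFun A φ) 0 / r) (by
      rw [sub_pos, div_lt_iff₀ hr', mul_comm]
      exact max_lt hlt hpos)).exists
  have hm' : (0 : ℝ) < (⌈r * n i⌉₊ : ℝ) := Nat.cast_pos.2 (hm i)
  have hceil : (r : ℝ) * n i ≤ (⌈r * n i⌉₊ : ℝ) := by exact_mod_cast Nat.le_ceil (r * (n i : ℝ≥0))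
  have hmono := R.monotone (N (n i)) (statePow φ (n i))
  have habs := neg_abs_le (R.toFun _ (apply (N (n i)) (statePow φ (n i))) -
    R.toFun _ (statePow ψ ⌈r * n i⌉₊))
  rw [hA φ _ (hn i)] at hmono
  rw [div_lt_iff₀ hm'] at hi
  rw [hB ψ _ (hm i)] at hi habs
  -- Replacing rn by the larger ⌈rn⌉ preserves the upper bound only when the coefficient is
  -- nonnegative, hence the maximum with 0: R(φ) may be negative here.
  have hbound : n i * R.toFun A φ ≤ max (R.toFun A φ) 0 / r * ⌈r * n i⌉₊ :=
    calc n i * R.toFun A φ ≤ n i * max (R.toFun A φ) 0 := by gcongr; exact le_max_left _ _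
      _ = max (R.toFun A φ) 0 / r * (r * n i) := by field_simp
      _ ≤ _ := by gcongr
  linarith

end ResourceTheory.QRT

/-- If two maximally resourceful states `φ₀`, `φ₁` of a system `A` satisfy `r_conv(φ₀ → φ₁) > 1`
and the normalization constant of `A` is positive, then no resource measure is, even on the single
system `A`, conventionally normalized, asymptotically continuous and weakly additive. -/
theorem mainTheorem6 (Q : ResourceTheory.QRT) (Rmax : Q.Sys → ℝ) (A : Q.Sys)
    (φ₀ φ₁ : Q.State A) (h₀ : ResourceTheory.QRT.IsMaximal φ₀)
    (h₁ : ResourceTheory.QRT.IsMaximal φ₁)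
    (hconv : 1 < ResourceTheory.QRT.rConv φ₀ φ₁) (hRmax : 0 < Rmax A) :
    ¬ ∃ R : Q.ResourceMeasure, R.IsConventionallyNormalizedOn A (Rmax A) ∧
      R.IsAsymptoticallyContinuousOn A ∧ R.IsWeaklyAdditiveOn A := by
  rintro ⟨R, ⟨-, hmax⟩, hcont, hadd⟩
  -- A supremum above 1 has an achievable rate above 1, whether or not the supremum is finite or
  -- attained.
  obtain ⟨r, hr, hr1⟩ : ∃ r ∈ ResourceTheory.QRT.achievableRates φ₀ φ₁, 1 < (r : ℝ≥0∞) := by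
    simpa only [ResourceTheory.QRT.rConv, lt_iSup_iff, exists_prop] using hconv
  have hr1 : 1 < r := by exact_mod_cast hr1
  have hle := R.rate_mul_le hadd hadd hcont (by rwa [hmax φ₁ h₁])
    (zero_lt_one.trans hr1) hr
  -- Both states being maximal, the rate bound becomes r · `Rmax A` ≤ `Rmax A`, impossible for r > 1
  -- and `Rmax A` > 0.
  rw [hmax φ₀ h₀, hmax φ₁ h₁] at hle
  have hr1' : (1 : ℝ) < r := hr1
  nlinarith
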